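/- Let $n\in\mathbb{N}$, let $f:\mathbb{R}^n\to\mathbb{R}^n$ be locally Lipschitz, let $\delta\ge 0$, and let $W,U\subseteq\mathbb{R}^n$. Write $\mathcal{B}$ for the closed Euclidean unit ball. For $\eta\ge 0$ let $\mathcal{S}_\eta$ denote the differential inclusion $x'\in f(x)+\eta\mathcal{B}$. Its solutions are the locally absolutely continuous functions $\phi$ that satisfy the inclusion almost everywhere, each taken on its maximal interval of existence $[0,b)$, $0<b\le\infty$. For a set $W$ and $T\ge 0$ let $\mathcal{R}_\eta^{t\ge T}(W)$ be the set of all values $\phi(t)$ with $\phi$ a solution of $\mathcal{S}_\eta$, $\phi(0)\in W$, and $t\ge T$ in the domain of $\phi$, and put $\mathcal{R}_\eta(W)=\mathcal{R}_\eta^{t\ge 0}(W)$. For $A\subseteq\mathbb{R}^n$ put $\|x\|_A=\inf_{y\in A}|x-y|$ (with $\inf\emptyset=+\infty$) and $A+\varepsilon\mathcal{B}=\bigcup_{x\in A}\{y:|y-x|\le\varepsilon\}$. $\mathcal{S}_\eta$ satisfies the *reach-avoid-stay specification* $(W,U,\Omega)$ if all solutions of $\mathcal{S}_\eta$ starting in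 $W$ are defined for all $t\ge 0$, there is $T\ge 0$ with $\mathcal{R}_\eta^{t\ge T}(W)\subseteq\Omega$, and $\mathcal{R}_\eta(W)\cap U=\emptyset$. $\mathcal{S}_\eta$ satisfies the *stability with safety guarantee specification* $(W,U,A)$ if $A$ is closed and the following hold: - (uniform stability) for every $\varepsilon>0$ there is $\delta_\varepsilon>0$ such that every solution $\phi$ of $\mathcal{S}_\eta$ with $\|\phi(0)\|_A<\delta_\varepsilon$ is defined for all $t\ge 0$ and satisfies $\|\phi(t)\|_A<\varepsilon$ for all $t\ge 0$; - (uniform attractivity) there is $\rho>0$ such that for every $\varepsilon>0$ there is $T>0$ such that every solution $\phi$ of $\mathcal{S}_\eta$ with $\|\phi(0)\|_A<\rho$ is defined for all $t\ge 0$ and satisfies $\|\phi(t)\|_A<\varepsilon$ for all $t\ge T$; - (attraction of $W$) every solution $\phi$ of $\mathcal{S}_\eta$ with $\phi(0)\in W$ is defined for all $t\ge 0$ and $\lim_{t\to\infty}\|\phi(t)\|_A=0$; - (safety) $\mathcal{R}_\eta(W)\cap U=\emptyset$. Then the following hold. 1. If $W$ is compact and $\mathcal{S}_\delta$ satisfies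 the stability with safety guarantee specification $(W,U,A)$ for some set $A\subseteq\mathbb{R}^n$, then for every $\varepsilon>0$, $\mathcal{S}_\delta$ satisfies the reach-avoid-stay specification $(W,U,A+\varepsilon\mathcal{B})$. 2. If $\Omega\subseteq\mathbb{R}^n$ is compact and $\mathcal{S}_\delta$ satisfies the reach-avoid-stay specification $(W,U,\Omega)$, then there is a compact set $A\subseteq\Omega$ such that, for every $\delta'\in[0,\delta)$, $\mathcal{S}_{\delta'}$ satisfies the stability with safety guarantee specification $(W,U,A)$. -/

import Mathlib

open Set Filter Topology MeasureTheory

namespace PerturbedSystem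

/-- The state space `ℝⁿ` with the Euclidean norm. -/
abbrev State (n : ℕ) : Type := EuclideanSpace ℝ (Fin n)

variable {n : ℕ}

/-- The right-hand side `F_δ(x) = f(x) + δ𝓑` of the differential inclusion, with `𝓑` the closed
unit ball. -/
def rhs (f : State n → State n) (δ : ℝ) (x : State n) : Set (State n) :=
  {v | ∃ d : State n, ‖d‖ ≤ δ ∧ v = f x + d}

/-- `φ` restricted to `[0, b)`, where `0 < b ≤ ∞`, is a (Carathéodory) solution of the differential
inclusion `x' ∈ f(x) + δ𝓑`: it is absolutely continuous on compact subintervals and satisfies the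
inclusion at almost every time. Values of `φ` outside `[0, b)` are irrelevant. -/
def IsSolution (f : State n → State n) (δ : ℝ) (b : EReal) (φ : ℝ → State n) : Prop :=
  0 < b ∧
  (∀ T : ℝ, 0 ≤ T → (T : EReal) < b → AbsolutelyContinuousOnInterval φ 0 T) ∧
  (∀ᵐ t : ℝ, 0 < t → (t : EReal) < b → ∃ v ∈ rhs f δ (φ t), HasDerivAt φ v t)

/-- A solution on `[0, b)` that has no extension to a solution on a longer interval `[0, b')`. -/
def IsMaximalSolution (f : State n → State n) (δ : ℝ) (b : EReal) (φ : ℝ → State n) : Prop :=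
  IsSolution f δ b φ ∧
  ∀ (b' : EReal) (ψ : ℝ → State n), IsSolution f δ b' ψ →
    (∀ t : ℝ, 0 ≤ t → (t : EReal) < b → ψ t = φ t) → b' ≤ b

/-- `Φ_δ(x₀)`: the solutions starting from `x₀`, each on its maximal interval of existence. An
element is a pair `(b, φ)`, standing for the solution `φ` with domain `[0, b)`. -/
def solutions (f : State n → State n) (δ : ℝ) (x₀ : State n) : Set (EReal × (ℝ → State n)) :=
  {p | IsMaximalSolution f δ p.1 p.2 ∧ p.2 0 = x₀}

/-- All solutions starting from the set `W` are defined for all positive time. -/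
def ForwardComplete (f : State n → State n) (δ : ℝ) (W : Set (State n)) : Prop :=
  ∀ x₀ ∈ W, ∀ p ∈ solutions f δ x₀, p.1 = ⊤

/-- `R_δ^t(W)`: the points reached at time `t` by solutions starting from `W`. -/
def reachAt (f : State n → State n) (δ : ℝ) (t : ℝ) (W : Set (State n)) : Set (State n) :=
  {y | ∃ x₀ ∈ W, ∃ p ∈ solutions f δ x₀, (t : EReal) < p.1 ∧ p.2 t = y}

/-- `R_δ^{t ≥ T}(W)`: the points reached at some time `t ≥ T` (with `T ≥ 0`) from `W`. -/
def reachFrom (f : State n → State n) (δ : ℝ) (T : ℝ) (W : Set (State n)) : Set (State n) :=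
  ⋃ t ∈ Ici T, reachAt f δ t W

/-- `R_δ(W)`: the points reached at some time `t ≥ 0` from `W`. -/
def reach (f : State n → State n) (δ : ℝ) (W : Set (State n)) : Set (State n) :=
  reachFrom f δ 0 W

/-- The reach-avoid-stay specification `(W, U, Ω)`. -/
def ReachAvoidStay (f : State n → State n) (δ : ℝ) (W U Ω : Set (State n)) : Prop :=
  (ForwardComplete f δ W ∧ ∃ T : ℝ, 0 ≤ T ∧ reachFrom f δ T W ⊆ Ω) ∧
  reach f δ W ∩ U = ∅

/-- Uniform stability of a set. The distance to `A` is the extended one, so that it is `∞` when `A`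
is empty. -/
def UniformlyStable (f : State n → State n) (δ : ℝ) (A : Set (State n)) : Prop :=
  ∀ ε : ℝ, 0 < ε → ∃ η : ℝ, 0 < η ∧
    ∀ x₀ : State n, Metric.infEDist x₀ A < ENNReal.ofReal η →
      ∀ p ∈ solutions f δ x₀,
        p.1 = ⊤ ∧ ∀ t : ℝ, 0 ≤ t → Metric.infEDist (p.2 t) A < ENNReal.ofReal ε

/-- Uniform attractivity of a set. -/
def UniformlyAttractive (f : State n → State n) (δ : ℝ) (A : Set (State n)) : Prop :=
  ∃ ρ : ℝ, 0 < ρ ∧ ∀ ε : ℝ, 0 < ε → ∃ T : ℝ, 0 < T ∧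
    ∀ x₀ : State n, Metric.infEDist x₀ A < ENNReal.ofReal ρ →
      ∀ p ∈ solutions f δ x₀,
        p.1 = ⊤ ∧ ∀ t : ℝ, T ≤ t → Metric.infEDist (p.2 t) A < ENNReal.ofReal ε

/-- Uniform asymptotic stability (UAS) of a set. -/
def UniformlyAsymptoticallyStable (f : State n → State n) (δ : ℝ) (A : Set (State n)) : Prop :=
  UniformlyStable f δ A ∧ UniformlyAttractive f δ A

/-- The domain of attraction `G_δ(A)`. -/
def domainOfAttraction (f : State n → State n) (δ : ℝ) (A : Set (State n)) : Set (State n) :=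
  {x₀ | ∀ p ∈ solutions f δ x₀,
    p.1 = ⊤ ∧ Tendsto (fun t : ℝ => Metric.infEDist (p.2 t) A) atTop (𝓝 0)}

/-- The stability with safety guarantee specification `(W, U, A)`. -/
def StabilityWithSafety (f : State n → State n) (δ : ℝ) (W U A : Set (State n)) : Prop :=
  (IsClosed A ∧ UniformlyAsymptoticallyStable f δ A ∧ W ⊆ domainOfAttraction f δ A) ∧
  reach f δ W ∩ U = ∅

/-- The closed `r`-neighbourhood `A + r𝓑`, the union of the closed balls of radius `r` centred at
points of `A`. -/
def nbhd (A : Set (State n)) (r : ℝ) : Set (State n) :=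
  ⋃ x ∈ A, Metric.closedBall x r

end PerturbedSystem

namespace PerturbedSystem

variable {n : ℕ}

/-! Everything is done with the integrated inclusion `SolOn`, which is equivalent to the
almost-everywhere one (`isSolution_iff`) but passes directly to pointwise limits and concatenations.

Item 2. Take for `A` the closure of the set of points of `Ω` that no `δ`-solution can carry out of
`Ω`. If a `δ'`-solution `φ` starts near a point `y` of this set, add to it the displacement `y - φ
0`, scaled down linearly to zero over one time unit. The slope changes by at most `‖y - φ 0‖` and
`f` by at most `L` times that, so the gap `δ - δ'` pays for both and the new curve is a `δ`-solution
(`SolOn.add_decay`). It starts at `y`, hence never leaves the set; so `φ` stays within `‖y - φ 0‖`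
of the set and lies in it from time `1` on (`IsMaximalSolution.shadow`). This gives stability and
attraction in finite time, with one `A` for all `δ'`. Solutions from `W` enter the set by the time
`T` of the specification, by concatenation.

Item 1. If no `T` worked, there would be solutions from `W` outside the `ε`-neighbourhood at
arbitrarily late times. By uniform stability each has kept a fixed distance `η` from `A` until then.
Compactness of the solutions from `W` (`exists_tendsto_of_forwardComplete`) yields a limit solution
that keeps this distance forever, contradicting attraction. -/

/-- `φ` satisfies the integrated form of the differential inclusion on `[a, c]`: the increments of
`φ` differ from the integrals of `f ∘ φ` by at most `δ` times the elapsed time. -/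
def SolOn (f : State n → State n) (δ a c : ℝ) (φ : ℝ → State n) : Prop :=
  ContinuousOn φ (Icc a c) ∧
  ∀ s t : ℝ, a ≤ s → s ≤ t → t ≤ c → ‖φ t - φ s - ∫ u in s..t, f (φ u)‖ ≤ δ * (t - s)

/-! ### Calculus of the integrated inclusion -/

section SolOn

variable {f : State n → State n} {δ a c : ℝ} {φ ψ : ℝ → State n}

theorem SolOn.intervalIntegrable (hf : Continuous f) (h : SolOn f δ a c φ) {s t : ℝ}
    (hs : a ≤ s) (hst : s ≤ t) (ht : t ≤ c) :
    IntervalIntegrable (fun u => f (φ u)) volume s t := by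
  apply ContinuousOn.intervalIntegrable
  rw [uIcc_of_le hst]
  exact hf.comp_continuousOn (h.1.mono (Icc_subset_Icc hs ht))

theorem SolOn.mono (h : SolOn f δ a c φ) {a' c' : ℝ} (ha : a ≤ a') (hc : c' ≤ c) :
    SolOn f δ a' c' φ :=
  ⟨h.1.mono (Icc_subset_Icc ha hc), fun s t hs hst ht =>
    h.2 s t (ha.trans hs) hst (ht.trans hc)⟩

theorem SolOn.mono_radius (h : SolOn f δ a c φ) {δ' : ℝ} (hδ : δ ≤ δ') : SolOn f δ' a c φ :=
  ⟨h.1, fun s t hs hst ht =>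
    (h.2 s t hs hst ht).trans (mul_le_mul_of_nonneg_right hδ (sub_nonneg.2 hst))⟩

theorem SolOn.congr (h : SolOn f δ a c φ) (he : ∀ t ∈ Icc a c, ψ t = φ t) :
    SolOn f δ a c ψ := by
  refine ⟨h.1.congr he, fun s t hs hst ht => ?_⟩
  have hint : ∫ u in s..t, f (ψ u) = ∫ u in s..t, f (φ u) := by
    apply intervalIntegral.integral_congr
    intro u hu
    rw [uIcc_of_le hst] at hu
    simp only [he u ⟨hs.trans hu.1, hu.2.trans ht⟩]
  rw [hint, he t ⟨hs.trans hst, ht⟩, he s ⟨hs, hst.trans ht⟩]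
  exact h.2 s t hs hst ht

theorem SolOn.shift (h : SolOn f δ a c φ) (r : ℝ) :
    SolOn f δ (a - r) (c - r) (fun t => φ (t + r)) := by
  refine ⟨h.1.comp (by fun_prop) fun t ht => ⟨by linarith [ht.1], by linarith [ht.2]⟩,
    fun s t hs hst ht => ?_⟩
  rw [intervalIntegral.integral_comp_add_right (fun u => f (φ u)) r]
  have := h.2 (s + r) (t + r) (by linarith) (by linarith) (by linarith)
  rwa [add_sub_add_right_eq_sub] at this

theorem SolOn.glue (hf : Continuous f) {m : ℝ} (h₁ : SolOn f δ a m φ) (h₂ : SolOn f δ m c φ)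
    (ham : a ≤ m) (hmc : m ≤ c) : SolOn f δ a c φ := by
  have hcont : ContinuousOn φ (Icc a c) := by
    rw [← Icc_union_Icc_eq_Icc ham hmc]
    exact h₁.1.union_of_isClosed h₂.1 isClosed_Icc isClosed_Icc
  refine ⟨hcont, fun s t hs hst ht => ?_⟩
  rcases le_total t m with htm | hmt
  · exact h₁.2 s t hs hst htm
  rcases le_total m s with hms | hsm
  · exact h₂.2 s t hms hst ht
  have e := intervalIntegral.integral_add_adjacent_intervals
    (h₁.intervalIntegrable hf hs hsm le_rfl) (h₂.intervalIntegrable hf le_rfl hmt ht)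
  have h1 := h₁.2 s m hs hsm le_rfl
  have h2 := h₂.2 m t le_rfl hmt ht
  rw [← e]
  calc ‖φ t - φ s - ((∫ u in s..m, f (φ u)) + ∫ u in m..t, f (φ u))‖
      = ‖(φ m - φ s - ∫ u in s..m, f (φ u)) + (φ t - φ m - ∫ u in m..t, f (φ u))‖ := by
        congr 1; abel
    _ ≤ δ * (m - s) + δ * (t - m) := (norm_add_le _ _).trans (add_le_add h1 h2)
    _ = δ * (t - s) := by ring

theorem SolOn.norm_sub_le (h : SolOn f δ a c φ) {M : ℝ}
    (hM : ∀ t ∈ Icc a c, ‖f (φ t)‖ ≤ M) {s t : ℝ} (hs : a ≤ s) (hst : s ≤ t) (ht : t ≤ c) :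
    ‖φ t - φ s‖ ≤ (M + δ) * (t - s) := by
  have h1 := h.2 s t hs hst ht
  have h2 : ‖∫ u in s..t, f (φ u)‖ ≤ M * |t - s| := by
    apply intervalIntegral.norm_integral_le_of_norm_le_const
    intro u hu
    rw [uIoc_of_le hst] at hu
    exact hM u ⟨hs.trans hu.1.le, hu.2.trans ht⟩
  rw [abs_of_nonneg (sub_nonneg.2 hst)] at h2
  have h3 := norm_add_le (φ t - φ s - ∫ u in s..t, f (φ u)) (∫ u in s..t, f (φ u))
  rw [sub_add_cancel] at h3
  linarith

theorem SolOn.lipschitzOnWith (h : SolOn f δ a c φ) {M : ℝ}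
    (hM : ∀ t ∈ Icc a c, ‖f (φ t)‖ ≤ M) : LipschitzOnWith (M + δ).toNNReal φ (Icc a c) := by
  apply LipschitzOnWith.of_dist_le_mul
  have key : ∀ s ∈ Icc a c, ∀ t ∈ Icc a c, s ≤ t →
      dist (φ t) (φ s) ≤ (M + δ).toNNReal * dist t s := by
    intro s hs t ht hst
    rw [dist_eq_norm, Real.dist_eq, abs_of_nonneg (sub_nonneg.2 hst)]
    exact (h.norm_sub_le hM hs.1 hst ht.2).trans
      (mul_le_mul_of_nonneg_right (Real.le_coe_toNNReal _) (sub_nonneg.2 hst))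
  intro s hs t ht
  rcases le_total s t with hst | hts
  · rw [dist_comm (φ s), dist_comm s]
    exact key s hs t ht hst
  · exact key t ht s hs hts

theorem SolOn.exists_norm_le (hf : Continuous f) (h : SolOn f δ a c φ) :
    ∃ M, ∀ t ∈ Icc a c, ‖f (φ t)‖ ≤ M :=
  isCompact_Icc.exists_bound_of_continuousOn (hf.comp_continuousOn h.1)

/-- A curve satisfying the integrated inclusion on every `[a, t]`, `t < c`, satisfies it on `[a, c]`
if it is continuous there. -/
theorem SolOn.of_forall_lt (hf : Continuous f) (hφ : ContinuousOn φ (Icc a c))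
    (h : ∀ t, t < c → SolOn f δ a t φ) : SolOn f δ a c φ := by
  refine ⟨hφ, fun s t hs hst ht => ?_⟩
  rcases ht.lt_or_eq with ht | rfl
  · exact (h t ht).2 s t hs hst le_rfl
  rcases hst.eq_or_lt with rfl | hst
  · simp
  have hφ' : ContinuousOn φ (Icc s t) := hφ.mono (Icc_subset_Icc_left hs)
  have hint : ContinuousOn (fun r => ∫ u in s..r, f (φ u)) (Icc s t) := by
    have := intervalIntegral.continuousOn_primitive_interval'
      (μ := volume) (f := fun u => f (φ u)) (a := s) (b₁ := s) (b₂ := t)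
      ((hf.comp_continuousOn (hφ'.mono (uIcc_of_le hst.le).subset)).intervalIntegrable)
      left_mem_uIcc
    rwa [uIcc_of_le hst.le] at this
  have hcl : t ∈ closure (Ico s t) := by
    rw [closure_Ico hst.ne]; exact ⟨hst.le, le_rfl⟩
  have hmem : t ∈ Icc s t := ⟨hst.le, le_rfl⟩
  refine ContinuousWithinAt.closure_le
    (f := fun r => ‖φ r - φ s - ∫ u in s..r, f (φ u)‖) (g := fun r => δ * (r - s)) hcl ?_ ?_ ?_
  · exact ((((hφ' t hmem).sub continuousWithinAt_const).sub (hint t hmem)).norm).mono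
      Ico_subset_Icc_self
  · fun_prop
  · exact fun r hr => (h r hr.2).2 s r hs hr.1 le_rfl

end SolOn

/-! ### A priori bounds, limits of solutions, local existence -/

/-- Continuous induction for a bound: if a continuous function satisfies a strict bound whenever
it satisfied the weak bound up to now, it satisfies the strict bound throughout. -/
theorem lt_of_forall_le_imp_lt {g : ℝ → ℝ} {a c B : ℝ} (hg : ContinuousOn g (Icc a c))
    (ha : g a ≤ B) (h : ∀ t ∈ Icc a c, (∀ s ∈ Icc a t, g s ≤ B) → g t < B) :
    ∀ t ∈ Icc a c, g t < B := by
  have hsub : Icc a c ⊆ {t | g t ≤ B} := by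
    apply IsClosed.Icc_subset_of_forall_mem_nhdsGT_of_Icc_subset
    · have := hg.preimage_isClosed_of_isClosed isClosed_Icc (isClosed_Iic (a := B))
      rwa [inter_comm] at this
    · exact ha
    · intro t ht hsub
      have hlt := h t ⟨ht.1, ht.2.le⟩ fun s hs => hsub hs
      have hev := (hg t ⟨ht.1, ht.2.le⟩).eventually (gt_mem_nhds hlt)
      have hle : 𝓝[>] t ≤ 𝓝[Icc a c] t := by
        rw [← nhdsWithin_Ioc_eq_nhdsGT ht.2]
        exact nhdsWithin_mono _ fun r hr => ⟨ht.1.trans hr.1.le, hr.2⟩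
      filter_upwards [hle hev] with r hr using le_of_lt hr
  exact fun t ht => h t ht fun s hs => hsub ⟨hs.1, hs.2.trans ht.2⟩

section SolOn

variable {f : State n → State n} {δ a c : ℝ} {φ ψ : ℝ → State n}

/-- Exit time bound: a solution starting in the ball of radius `R` stays in the ball of radius
`R + 1` for a time bounded below in terms of the speed on the larger ball. -/
theorem SolOn.norm_le_add_one (h : SolOn f δ a c φ) {R M : ℝ}
    (hM : ∀ x, ‖x‖ ≤ R + 1 → ‖f x‖ ≤ M) (hR : ‖φ a‖ ≤ R) (hMδ : 0 ≤ M + δ)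
    (hc : (M + δ) * (c - a) < 1) :
    ∀ t ∈ Icc a c, ‖φ t‖ ≤ R + 1 := by
  intro t ht
  refine (lt_of_forall_le_imp_lt h.1.norm (by linarith) (fun t ht hs => ?_) t ht).le
  have h1 := (h.mono le_rfl ht.2).norm_sub_le (M := M) (fun s hs' => hM _ (hs s hs'))
    le_rfl ht.1 le_rfl
  have h2 : (M + δ) * (t - a) ≤ (M + δ) * (c - a) :=
    mul_le_mul_of_nonneg_left (by linarith [ht.2]) hMδ
  have h3 := norm_add_le (φ t - φ a) (φ a)
  rw [sub_add_cancel] at h3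
  linarith

/-- The integrated inclusion passes to pointwise limits of uniformly bounded solutions. -/
theorem SolOn.of_tendsto (hf : LocallyLipschitz f) {ι : Type*} {l : Filter ι} [l.NeBot]
    {Φ : ι → ℝ → State n} (hΦ : ∀ᶠ k in l, SolOn f δ a c (Φ k)) {R : ℝ}
    (hR : ∀ᶠ k in l, ∀ t ∈ Icc a c, ‖Φ k t‖ ≤ R)
    (hlim : ∀ t ∈ Icc a c, Tendsto (fun k => Φ k t) l (𝓝 (φ t))) : SolOn f δ a c φ := by
  have hK : IsCompact (Metric.closedBall (0 : State n) R) := isCompact_closedBall _ _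
  obtain ⟨M, hM⟩ := hK.exists_bound_of_continuousOn hf.continuous.continuousOn
  obtain ⟨L, hL⟩ := hf.locallyLipschitzOn.exists_lipschitzOnWith_of_compact hK
  have hΦlip : ∀ᶠ k in l, LipschitzOnWith (M + δ).toNNReal (Φ k) (Icc a c) := by
    filter_upwards [hΦ, hR] with k hk hk'
    exact hk.lipschitzOnWith fun t ht => hM _ (mem_closedBall_zero_iff.2 (hk' t ht))
  have hφR : ∀ t ∈ Icc a c, φ t ∈ Metric.closedBall (0 : State n) R := by
    intro t ht
    apply mem_closedBall_zero_iff.2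
    refine le_of_tendsto (hlim t ht).norm ?_
    filter_upwards [hR] with k hk using hk t ht
  have hφlip : LipschitzOnWith (M + δ).toNNReal φ (Icc a c) := by
    apply LipschitzOnWith.of_dist_le_mul
    intro s hs t ht
    refine le_of_tendsto ((hlim s hs).dist (hlim t ht)) ?_
    filter_upwards [hΦlip] with k hk using hk.dist_le_mul s hs t ht
  set C : ℝ := L * (M + δ).toNNReal with hC
  have hC0 : 0 ≤ C := by positivity
  -- Pointwise convergence is uniform on the compact interval because the curves share a Lipschitz
  -- constant. For a general filter this is obtained by compact induction over small neighbourhoods.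
  have hunif : ∀ ε > 0, ∀ᶠ k in l, ∀ t ∈ Icc a c, ‖f (Φ k t) - f (φ t)‖ ≤ ε := by
    intro ε hε
    have key := isCompact_Icc.induction_on (s := Icc a c)
      (p := fun s => ∀ᶠ k in l, ∀ t ∈ s ∩ Icc a c, ‖f (Φ k t) - f (φ t)‖ ≤ ε)
      (by simp) (fun s t hst h => h.mono fun k hk r hr => hk r ⟨hst hr.1, hr.2⟩)
      (fun s t h1 h2 => by
        filter_upwards [h1, h2] with k hk1 hk2 r hr
        exact hr.1.elim (fun h => hk1 r ⟨h, hr.2⟩) fun h => hk2 r ⟨h, hr.2⟩)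
      (fun t ht => by
        have hr : 0 < ε / (3 * (C + 1)) := by positivity
        refine ⟨_, inter_mem_nhdsWithin _ (Metric.ball_mem_nhds t hr), ?_⟩
        have ht' : ∀ᶠ k in l, ‖f (Φ k t) - f (φ t)‖ < ε / 3 := by
          have := ((hf.continuous.tendsto (φ t)).comp (hlim t ht)).sub_const (f (φ t))
          rw [sub_self] at this
          exact (this.norm.eventually (gt_mem_nhds (by rw [norm_zero]; positivity)))
        filter_upwards [ht', hΦlip, hR] with k hk hlip hkR s hs
        have hst : dist s t < ε / (3 * (C + 1)) := hs.1.2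
        have hCs : C * dist s t ≤ ε / 3 := by
          have h1 : C * dist s t ≤ (C + 1) * (ε / (3 * (C + 1))) :=
            mul_le_mul (by linarith) hst.le dist_nonneg (by linarith)
          have h2 : (C + 1) * (ε / (3 * (C + 1))) = ε / 3 := by field_simp
          linarith
        have h1 : ‖f (Φ k s) - f (Φ k t)‖ ≤ C * dist s t := by
          rw [← dist_eq_norm]
          refine (hL.dist_le_mul _ (mem_closedBall_zero_iff.2 (hkR s hs.2)) _
            (mem_closedBall_zero_iff.2 (hkR t ht))).trans ?_
          rw [hC, mul_assoc]
          exact mul_le_mul_of_nonneg_left (hlip.dist_le_mul s hs.2 t ht) L.2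
        have h2 : ‖f (φ t) - f (φ s)‖ ≤ C * dist s t := by
          rw [← dist_eq_norm, dist_comm]
          refine (hL.dist_le_mul _ (hφR s hs.2) _ (hφR t ht)).trans ?_
          rw [hC, mul_assoc]
          exact mul_le_mul_of_nonneg_left (hφlip.dist_le_mul s hs.2 t ht) L.2
        have h3 : f (Φ k s) - f (φ s) =
            (f (Φ k s) - f (Φ k t)) + (f (Φ k t) - f (φ t)) + (f (φ t) - f (φ s)) := by abel
        rw [h3]
        refine (norm_add₃_le).trans ?_
        linarith)
    filter_upwards [key] with k hk t ht using hk t ⟨ht, ht⟩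
  refine ⟨hφlip.continuousOn, fun s t hs hst ht => ?_⟩
  have hsI : s ∈ Icc a c := ⟨hs, hst.trans ht⟩
  have htI : t ∈ Icc a c := ⟨hs.trans hst, ht⟩
  have hfφ : IntervalIntegrable (fun u => f (φ u)) volume s t := by
    apply ContinuousOn.intervalIntegrable
    rw [uIcc_of_le hst]
    exact hf.continuous.comp_continuousOn (hφlip.continuousOn.mono (Icc_subset_Icc hs ht))
  have hε : ∀ ε > 0, ‖φ t - φ s - ∫ u in s..t, f (φ u)‖ ≤ δ * (t - s) + ε * (t - s) := by
    intro ε hε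
    have hlim' : Tendsto (fun k => Φ k t - Φ k s - ∫ u in s..t, f (φ u)) l
        (𝓝 (φ t - φ s - ∫ u in s..t, f (φ u))) :=
      ((hlim t htI).sub (hlim s hsI)).sub_const _
    refine le_of_tendsto hlim'.norm ?_
    filter_upwards [hΦ, hunif ε hε] with k hk hkε
    have h1 : ‖∫ u in s..t, (f (Φ k u) - f (φ u))‖ ≤ ε * |t - s| := by
      apply intervalIntegral.norm_integral_le_of_norm_le_const
      intro u hu
      rw [uIoc_of_le hst] at hu
      exact hkε u ⟨hs.trans hu.1.le, hu.2.trans ht⟩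
    rw [abs_of_nonneg (sub_nonneg.2 hst), intervalIntegral.integral_sub
      (hk.intervalIntegrable hf.continuous hs hst ht) hfφ] at h1
    have h2 := norm_add_le (Φ k t - Φ k s - ∫ u in s..t, f (Φ k u))
      ((∫ u in s..t, f (Φ k u)) - ∫ u in s..t, f (φ u))
    rw [sub_add_sub_cancel] at h2
    linarith [hk.2 s t hs hst ht]
  refine le_of_forall_pos_le_add fun ε hε' => ?_
  -- The `+ 1` keeps the divisor positive when `s = t`.
  have hts : 0 < t - s + 1 := by linarith
  refine (hε (ε / (t - s + 1)) (by positivity)).trans ?_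
  gcongr
  rw [div_mul_eq_mul_div, div_le_iff₀ hts]
  exact mul_le_mul_of_nonneg_left (by linarith) hε'.le

/-- Local existence of an integral curve of `f`, by Picard–Lindelöf. -/
theorem exists_solOn (hf : LocallyLipschitz f) (x : State n) :
    ∃ h > 0, ∃ φ : ℝ → State n, φ 0 = x ∧ SolOn f 0 0 h φ := by
  have hK : IsCompact (Metric.closedBall x 1) := isCompact_closedBall _ _
  obtain ⟨M, hM⟩ := hK.exists_bound_of_continuousOn hf.continuous.continuousOn
  obtain ⟨L, hL⟩ := hf.locallyLipschitzOn.exists_lipschitzOnWith_of_compact hK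
  have hM' : 0 < (M.toNNReal : ℝ) + 1 := by positivity
  -- At speed at most `M` the curve cannot leave the unit ball around `x` within this time.
  set h : ℝ := 1 / ((M.toNNReal : ℝ) + 1) with hh
  have hh0 : 0 < h := by positivity
  have hPL : IsPicardLindelof (fun _ => f) (tmin := 0) (tmax := h) ⟨0, le_rfl, hh0.le⟩ x 1 0
      M.toNNReal L := by
    apply IsPicardLindelof.of_time_independent
    · exact fun y hy => (hM y hy).trans (Real.le_coe_toNNReal _)
    · exact hL
    · simp only [sub_zero, sub_self, NNReal.coe_one, NNReal.coe_zero]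
      rw [max_eq_left hh0.le, hh, mul_one_div, div_le_one hM']
      linarith
  obtain ⟨φ, hφ0, hφ⟩ := hPL.exists_eq_forall_mem_Icc_hasDerivWithinAt₀
  refine ⟨h, hh0, φ, hφ0, fun t ht => (hφ t ht).continuousWithinAt, fun s t hs hst ht => ?_⟩
  have hcont : ContinuousOn φ (Icc s t) := fun r hr =>
    (hφ r ⟨hs.trans hr.1, hr.2.trans ht⟩).continuousWithinAt.mono (Icc_subset_Icc hs ht)
  have := intervalIntegral.integral_eq_sub_of_hasDerivAt_of_le hst hcont
    (f' := fun u => f (φ u)) (fun u hu =>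
      (hφ u ⟨hs.trans hu.1.le, hu.2.le.trans ht⟩).hasDerivAt
        (Icc_mem_nhds (hs.trans_lt hu.1) (hu.2.trans_le ht)))
    (by
      apply ContinuousOn.intervalIntegrable
      rw [uIcc_of_le hst]
      exact hf.continuous.comp_continuousOn hcont)
  rw [this, sub_self, norm_zero, zero_mul]

end SolOn

/-! ### Equivalence of the almost-everywhere and integrated inclusions -/

theorem _root_.LipschitzWith.comp_absolutelyContinuousOnInterval {X Y : Type*}
    [PseudoMetricSpace X] [PseudoMetricSpace Y] {K : NNReal} {g : X → Y} (hg : LipschitzWith K g)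
    {φ : ℝ → X} {a c : ℝ} (h : AbsolutelyContinuousOnInterval φ a c) :
    AbsolutelyContinuousOnInterval (fun t => g (φ t)) a c := by
  have h0 : Tendsto (fun E : ℕ × (ℕ → ℝ × ℝ) =>
      (K : ℝ) * ∑ i ∈ Finset.range E.1, dist (φ (E.2 i).1) (φ (E.2 i).2))
      (AbsolutelyContinuousOnInterval.totalLengthFilter ⊓
        𝓟 (AbsolutelyContinuousOnInterval.disjWithin a c)) (𝓝 0) := by
    simpa using Tendsto.const_mul (K : ℝ) h
  refine squeeze_zero (fun E => Finset.sum_nonneg fun i _ => dist_nonneg) (fun E => ?_) h0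
  rw [Finset.mul_sum]
  exact Finset.sum_le_sum fun i _ => hg.dist_le_mul _ _

/-- Mean value inequality for absolutely continuous curves in an inner product space whose
derivative is bounded almost everywhere. -/
theorem _root_.AbsolutelyContinuousOnInterval.norm_sub_le {E : Type*} [NormedAddCommGroup E]
    [InnerProductSpace ℝ E] {g g' : ℝ → E} {s t C : ℝ} (hst : s ≤ t)
    (hg : AbsolutelyContinuousOnInterval g s t)
    (hd : ∀ᵐ u, u ∈ Ioo s t → HasDerivAt g (g' u) u ∧ ‖g' u‖ ≤ C) :
    ‖g t - g s‖ ≤ C * (t - s) := by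
  -- Pairing with the increment itself reduces to the scalar fundamental theorem of calculus and
  -- gives `‖v‖² ≤ ‖v‖ C (t - s)`.
  set v := g t - g s with hv
  set p : ℝ → ℝ := fun u => inner ℝ v (g u) with hp
  have hpAC : AbsolutelyContinuousOnInterval p s t :=
    (innerSL ℝ v).lipschitz.comp_absolutelyContinuousOnInterval hg
  have hint := hpAC.integral_deriv_eq_sub
  have hne : ∀ᵐ u : ℝ, u ≠ t := by simp [ae_iff, measure_singleton]
  have hbd : ‖∫ u in s..t, deriv p u‖ ≤ ‖v‖ * C * |t - s| := by
    apply intervalIntegral.norm_integral_le_of_norm_le_const_ae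
    filter_upwards [hd, hne] with u hu hut hmem
    rw [uIoc_of_le hst] at hmem
    obtain ⟨h1, h2⟩ := hu ⟨hmem.1, lt_of_le_of_ne hmem.2 hut⟩
    have h3 : HasDerivAt p (inner ℝ v (g' u)) u :=
      (innerSL ℝ v).hasFDerivAt.comp_hasDerivAt u h1
    rw [h3.deriv]
    exact (norm_inner_le_norm v (g' u)).trans (mul_le_mul_of_nonneg_left h2 (norm_nonneg _))
  have hpv : p t - p s = ‖v‖ * ‖v‖ := by
    rw [hp]
    simp only
    rw [← inner_sub_right, ← hv, real_inner_self_eq_norm_mul_norm]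
  rw [hint, hpv, abs_of_nonneg (sub_nonneg.2 hst), Real.norm_of_nonneg (by positivity),
    mul_assoc] at hbd
  rcases (norm_nonneg v).eq_or_lt with h0 | h0
  · rcases hst.eq_or_lt with rfl | hlt
    · rw [← h0]; simp
    -- When `v = 0` nothing can be cancelled; instead `C ≥ 0`, since the derivative bound holds
    -- somewhere on an interval of positive measure.
    · have hC : 0 ≤ C := by
        have hvol : volume (Ioo s t) ≠ 0 := by simp [hlt]
        by_contra hC
        apply hvol
        refine measure_mono_null (fun u hu => ?_) hd
        intro hcon
        exact hC ((norm_nonneg _).trans (hcon hu).2)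
      rw [← h0]
      exact mul_nonneg hC (sub_nonneg.2 hst)
  · exact le_of_mul_le_mul_left hbd h0

section

variable {f : State n → State n} {δ : ℝ} {b : EReal} {φ ψ : ℝ → State n}

theorem hasDerivAt_primitive {g : ℝ → State n} {a c : ℝ} (hg : ContinuousOn g (Icc a c)) {t : ℝ}
    (ht : t ∈ Ioo a c) : HasDerivAt (fun t => ∫ u in a..t, g u) (g t) t := by
  apply intervalIntegral.integral_hasDerivAt_right
  · apply ContinuousOn.intervalIntegrable
    rw [uIcc_of_le ht.1.le]
    exact hg.mono (Icc_subset_Icc_right ht.2.le)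
  · exact (hg.mono Ioo_subset_Icc_self).stronglyMeasurableAtFilter isOpen_Ioo t ht
  · exact hg.continuousAt (Icc_mem_nhds ht.1 ht.2)

/-- Subtracting the primitive of `f ∘ φ` leaves an absolutely continuous curve whose derivative is
almost everywhere the perturbation, of norm at most `δ`; the mean value inequality bounds its
increments. -/
theorem IsSolution.solOn (hf : Continuous f) (h : IsSolution f δ b φ) {T : ℝ} (hT : 0 ≤ T)
    (hTb : (T : EReal) < b) : SolOn f δ 0 T φ := by
  have hAC := h.2.1 T hT hTb
  have hφ : ContinuousOn φ (Icc 0 T) := by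
    have := hAC.continuousOn
    rwa [uIcc_of_le hT] at this
  have hfφ : ContinuousOn (fun u => f (φ u)) (Icc 0 T) := hf.comp_continuousOn hφ
  refine ⟨hφ, fun s t hs hst ht => ?_⟩
  have hfφ' : ContinuousOn (fun u => f (φ u)) (Icc s t) := hfφ.mono (Icc_subset_Icc hs ht)
  obtain ⟨M, hM⟩ := isCompact_Icc.exists_bound_of_continuousOn hfφ'
  have hprimAC : AbsolutelyContinuousOnInterval (fun r => ∫ u in s..r, f (φ u)) s t := by
    apply LipschitzOnWith.absolutelyContinuousOnInterval (K := M.toNNReal)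
    apply LipschitzOnWith.of_dist_le_mul
    rw [uIcc_of_le hst]
    intro x hx y hy
    have hI : ∀ z ∈ Icc s t, IntervalIntegrable (fun u => f (φ u)) volume s z := by
      intro z hz
      apply ContinuousOn.intervalIntegrable
      rw [uIcc_of_le hz.1]
      exact hfφ'.mono (Icc_subset_Icc_right hz.2)
    rw [dist_eq_norm, intervalIntegral.integral_interval_sub_left (hI x hx) (hI y hy),
      Real.dist_eq]
    apply intervalIntegral.norm_integral_le_of_norm_le_const
    intro u hu
    refine (hM u ?_).trans (Real.le_coe_toNNReal _)
    exact uIcc_subset_Icc hy hx (uIoc_subset_uIcc hu)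
  have hgAC : AbsolutelyContinuousOnInterval (fun r => φ r - ∫ u in s..r, f (φ u)) s t := by
    refine (hAC.mono ?_).sub hprimAC
    rw [uIcc_of_le hst, uIcc_of_le hT]
    exact Icc_subset_Icc hs ht
  have := hgAC.norm_sub_le (C := δ) (g' := fun u => deriv φ u - f (φ u)) hst (by
    filter_upwards [h.2.2] with u hu hmem
    obtain ⟨v, ⟨d, hd, rfl⟩, hv⟩ := hu (hs.trans_lt hmem.1)
      (lt_of_le_of_lt (EReal.coe_le_coe_iff.2 (hmem.2.le.trans ht)) hTb)
    rw [hv.deriv]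
    exact ⟨hv.sub (hasDerivAt_primitive hfφ' hmem), by simpa using hd⟩)
  simp only [intervalIntegral.integral_same, sub_zero] at this
  rwa [sub_right_comm] at this

theorem SolOn.absolutelyContinuousOnInterval (hf : Continuous f) {T : ℝ} (hT : 0 ≤ T)
    (h : SolOn f δ 0 T φ) : AbsolutelyContinuousOnInterval φ 0 T := by
  obtain ⟨M, hM⟩ := h.exists_norm_le hf
  apply LipschitzOnWith.absolutelyContinuousOnInterval (K := (M + δ).toNNReal)
  rw [uIcc_of_le hT]
  exact h.lipschitzOnWith hM

/-- The curve is Lipschitz, so differentiable almost everywhere by Rademacher; minus the primitive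
of `f ∘ φ` it is `δ`-Lipschitz, which bounds the derivative of the difference. -/
theorem SolOn.ae_hasDerivAt (hf : Continuous f) (hδ : 0 ≤ δ) {T : ℝ} (h : SolOn f δ 0 T φ) :
    ∀ᵐ t : ℝ, t ∈ Ioo 0 T → ∃ v ∈ rhs f δ (φ t), HasDerivAt φ v t := by
  obtain ⟨M, hM⟩ := h.exists_norm_le hf
  filter_upwards [(h.lipschitzOnWith hM).ae_differentiableWithinAt_of_mem_real] with t hdiff ht
  have hnhds : Icc 0 T ∈ 𝓝 t := Icc_mem_nhds ht.1 ht.2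
  have hd := ((hdiff ⟨ht.1.le, ht.2.le⟩).differentiableAt hnhds).hasDerivAt
  refine ⟨deriv φ t, ⟨deriv φ t - f (φ t), ?_, by abel⟩, hd⟩
  have hg := hd.sub (hasDerivAt_primitive (hf.comp_continuousOn h.1) ht)
  have hlip : LipschitzOnWith δ.toNNReal (fun r => φ r - ∫ u in (0:ℝ)..r, f (φ u))
      (Icc 0 T) := by
    apply LipschitzOnWith.of_dist_le_mul
    have key : ∀ r ∈ Icc 0 T, ∀ s ∈ Icc 0 T, r ≤ s →
        dist (φ s - ∫ u in (0:ℝ)..s, f (φ u)) (φ r - ∫ u in (0:ℝ)..r, f (φ u)) ≤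
          δ.toNNReal * dist s r := by
      intro r hr s hs hrs
      rw [dist_eq_norm, Real.dist_eq, abs_of_nonneg (sub_nonneg.2 hrs), Real.coe_toNNReal _ hδ]
      have e := intervalIntegral.integral_interval_sub_left
        (h.intervalIntegrable hf le_rfl hs.1 hs.2) (h.intervalIntegrable hf le_rfl hr.1 hr.2)
      have := h.2 r s hr.1 hrs hs.2
      rw [← e] at this
      refine (le_of_eq (congrArg norm ?_)).trans this
      abel
    intro r hr s hs
    rcases le_total s r with hsr | hrs
    · exact key s hs r hr hsr
    · rw [dist_comm, dist_comm r]
      exact key r hr s hs hrs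
  have := hg.le_of_lipschitzOn hnhds hlip
  rwa [Real.coe_toNNReal _ hδ] at this

theorem isSolution_iff (hf : Continuous f) (hδ : 0 ≤ δ) :
    IsSolution f δ b φ ↔ 0 < b ∧ ∀ T : ℝ, 0 ≤ T → (T : EReal) < b → SolOn f δ 0 T φ := by
  refine ⟨fun h => ⟨h.1, fun T hT hTb => h.solOn hf hT hTb⟩, fun h => ⟨h.1, fun T hT hTb =>
    (h.2 T hT hTb).absolutelyContinuousOnInterval hf hT, ?_⟩⟩
  -- Exhausting `[0, b)` by rational endpoints leaves only countably many null sets to discard.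
  have hq : ∀ᵐ t : ℝ, ∀ q : ℚ, 0 ≤ (q : ℝ) → ((q : ℝ) : EReal) < b → t ∈ Ioo 0 (q : ℝ) →
      ∃ v ∈ rhs f δ (φ t), HasDerivAt φ v t := by
    rw [ae_all_iff]
    intro q
    by_cases hq : 0 ≤ (q : ℝ) ∧ ((q : ℝ) : EReal) < b
    · filter_upwards [(h.2 q hq.1 hq.2).ae_hasDerivAt hf hδ] with t ht _ _ using ht
    · exact Eventually.of_forall fun t h1 h2 => absurd ⟨h1, h2⟩ hq
  filter_upwards [hq] with t ht h0 htb
  obtain ⟨q, hq1, hq2⟩ := EReal.exists_rat_btwn_of_lt htb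
  have hq1' : t < (q : ℝ) := by exact_mod_cast hq1
  exact ht q (h0.trans hq1').le (by exact_mod_cast hq2) ⟨h0, hq1'⟩

theorem SolOn.isSolution (hf : Continuous f) (hδ : 0 ≤ δ) {T : ℝ} (hT : 0 < T)
    (h : SolOn f δ 0 T φ) : IsSolution f δ T φ :=
  (isSolution_iff hf hδ).2 ⟨by exact_mod_cast hT, fun S _ hST =>
    h.mono le_rfl (EReal.coe_le_coe_iff.1 hST.le)⟩

/-! ### Maximal solutions: extension, concatenation, finite-time breakdown -/

theorem isMaximalSolution_top (h : IsSolution f δ ⊤ φ) : IsMaximalSolution f δ ⊤ φ :=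
  ⟨h, fun _ _ _ _ => le_top⟩

/-- Every solution extends to a maximal one. -/
theorem IsSolution.exists_isMaximalSolution (hf : Continuous f) (hδ : 0 ≤ δ)
    (h : IsSolution f δ b φ) :
    ∃ (b' : EReal) (ψ : ℝ → State n), IsMaximalSolution f δ b' ψ ∧ b ≤ b' ∧
      ∀ t : ℝ, 0 ≤ t → (t : EReal) < b → ψ t = φ t := by
  let α := {p : EReal × (ℝ → State n) // IsSolution f δ p.1 p.2 ∧ b ≤ p.1 ∧
    ∀ t : ℝ, 0 ≤ t → (t : EReal) < b → p.2 t = φ t}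
  -- Zorn's lemma for the extension preorder. It is not antisymmetric, as values outside the domain
  -- are arbitrary.
  let r : α → α → Prop := fun p q => p.1.1 ≤ q.1.1 ∧
    ∀ t : ℝ, 0 ≤ t → (t : EReal) < p.1.1 → q.1.2 t = p.1.2 t
  have : Nonempty α := ⟨⟨(b, φ), h, le_rfl, fun _ _ _ => rfl⟩⟩
  obtain ⟨m, hm⟩ := exists_maximal_of_nonempty_chains_bounded (r := r) (fun c hc hne => by
    classical
    obtain ⟨p₀, hp₀⟩ := hne
    let B : EReal := sSup ((fun p : α => p.1.1) '' c)
    -- The union of the chain: any member defined at `t` may be chosen, as members agree on common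
    -- domains.
    let χ : ℝ → State n := fun t =>
      if ht : ∃ p ∈ c, (t : EReal) < p.1.1 then ht.choose.1.2 t else 0
    have hχ : ∀ p ∈ c, ∀ t : ℝ, 0 ≤ t → (t : EReal) < p.1.1 → χ t = p.1.2 t := by
      intro p hp t h0 ht
      have hex : ∃ p ∈ c, (t : EReal) < p.1.1 := ⟨p, hp, ht⟩
      have e : χ t = hex.choose.1.2 t := dif_pos hex
      rw [e]
      obtain ⟨hq, htq⟩ := hex.choose_spec
      by_cases heq : hex.choose = p
      · rw [heq]
      rcases hc hq hp heq with h1 | h1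
      · exact (h1.2 t h0 htq).symm
      · exact h1.2 t h0 ht
    have hle : ∀ p ∈ c, p.1.1 ≤ B := fun p hp => le_sSup ⟨p, hp, rfl⟩
    refine ⟨⟨(B, χ), ?_, p₀.2.2.1.trans (hle _ hp₀), fun t h0 ht => ?_⟩,
      fun p hp => ⟨hle p hp, hχ p hp⟩⟩
    · rw [isSolution_iff hf hδ]
      refine ⟨p₀.2.1.1.trans_le (hle _ hp₀), fun T hT hTB => ?_⟩
      obtain ⟨_, ⟨p, hp, rfl⟩, hTp⟩ := lt_sSup_iff.1 hTB
      refine (p.2.1.solOn hf hT hTp).congr fun t ht => hχ p hp t ht.1 ?_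
      exact lt_of_le_of_lt (EReal.coe_le_coe_iff.2 ht.2) hTp
    · rw [← p₀.2.2.2 t h0 ht]
      exact hχ p₀ hp₀ t h0 (ht.trans_le p₀.2.2.1))
    (fun {p q s} h1 h2 => ⟨h1.1.trans h2.1, fun t h0 ht =>
      (h2.2 t h0 (ht.trans_le h1.1)).trans (h1.2 t h0 ht)⟩)
  refine ⟨m.1.1, m.1.2, ⟨m.2.1, fun b' ψ hψ he => ?_⟩, m.2.2⟩
  by_contra hlt
  rw [not_le] at hlt
  exact absurd (hm ⟨(b', ψ), hψ, m.2.2.1.trans hlt.le, fun t h0 ht =>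
    (he t h0 (ht.trans_le m.2.2.1)).trans (m.2.2.2 t h0 ht)⟩ ⟨hlt.le, he⟩).1 (not_le.2 hlt)

/-- Concatenation of solutions. -/
theorem SolOn.concat (hf : Continuous f) {T S : ℝ} (hT : 0 ≤ T) (hS : 0 ≤ S)
    (h : SolOn f δ 0 T φ) {χ : ℝ → State n} (hχ : SolOn f δ 0 S χ) (hχ0 : χ 0 = φ T) :
    ∃ ω : ℝ → State n, SolOn f δ 0 (T + S) ω ∧ (∀ t ∈ Icc 0 T, ω t = φ t) ∧ ω (T + S) = χ S := by
  let ω : ℝ → State n := fun t => if t ≤ T then φ t else χ (t - T)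
  have h1 : ∀ t ∈ Icc 0 T, ω t = φ t := fun t ht => if_pos ht.2
  have h2 : ∀ t ∈ Icc T (T + S), ω t = χ (t - T) := by
    intro t ht
    rcases ht.1.eq_or_lt with rfl | hlt
    · simp [ω, hχ0]
    · simp [ω, not_le.2 hlt]
  have h3 : SolOn f δ T (T + S) ω := by
    have := hχ.shift (-T)
    rw [zero_sub, neg_neg, sub_neg_eq_add, add_comm S] at this
    exact this.congr fun t ht => by rw [h2 t ht, sub_eq_add_neg]
  refine ⟨ω, (h.congr h1).glue hf h3 hT (by linarith), h1, ?_⟩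
  rw [h2 _ ⟨by linarith, le_rfl⟩, add_sub_cancel_left]

/-- A solution on a compact interval extends to a maximal solution, defined on a strictly longer
interval. -/
theorem SolOn.exists_isMaximalSolution (hf : LocallyLipschitz f) (hδ : 0 ≤ δ) {T : ℝ}
    (hT : 0 ≤ T) (h : SolOn f δ 0 T φ) :
    ∃ (b : EReal) (ψ : ℝ → State n), IsMaximalSolution f δ b ψ ∧ (T : EReal) < b ∧
      ∀ t ∈ Icc 0 T, ψ t = φ t := by
  -- A short unperturbed integral curve from the endpoint makes the interval strictly longer.
  obtain ⟨r, hr, χ, hχ0, hχ⟩ := exists_solOn hf (φ T)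
  obtain ⟨ω, hω, hωφ, -⟩ := h.concat hf.continuous hT hr.le (hχ.mono_radius hδ) hχ0
  have h3 : IsSolution f δ ((T + r : ℝ) : EReal) ω :=
    hω.isSolution hf.continuous hδ (by linarith)
  obtain ⟨b, ψ, hψ, hb, he⟩ := h3.exists_isMaximalSolution hf.continuous hδ
  refine ⟨b, ψ, hψ, lt_of_lt_of_le (EReal.coe_lt_coe_iff.2 (by linarith)) hb, fun t ht => ?_⟩
  rw [he t ht.1 (EReal.coe_lt_coe_iff.2 (by linarith [ht.2]))]
  exact hωφ t ht

/-- A maximal solution with bounded interval of existence `[0, β)` has no continuous extension to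
`[0, β]`. -/
theorem IsMaximalSolution.not_continuousOn (hf : LocallyLipschitz f) (hδ : 0 ≤ δ) {β : ℝ}
    (h : IsMaximalSolution f δ β φ) (he : ∀ t ∈ Ico 0 β, ψ t = φ t) :
    ¬ ContinuousOn ψ (Icc 0 β) := by
  intro hψ
  have hβ : 0 < β := by exact_mod_cast h.1.1
  have hlt : ∀ t, t < β → SolOn f δ 0 t ψ := by
    intro t ht
    rcases lt_or_ge t 0 with h0 | h0
    · exact ⟨by simp [h0], fun s u h1 h2 h3 => by linarith⟩
    · exact (h.1.solOn hf.continuous h0 (EReal.coe_lt_coe_iff.2 ht)).congr fun s hs =>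
        he s ⟨hs.1, hs.2.trans_lt ht⟩
  obtain ⟨b, χ, hχ, hb, heχ⟩ := (SolOn.of_forall_lt hf.continuous hψ
    hlt).exists_isMaximalSolution hf hδ hβ.le
  refine absurd (h.2 b χ hχ.1 fun t h0 ht => ?_) (not_le.2 hb)
  have ht' := EReal.coe_lt_coe_iff.1 ht
  rw [heχ t ⟨h0, ht'.le⟩, he t ⟨h0, ht'⟩]

/-- A maximal solution that stays bounded is defined for all time. -/
theorem IsMaximalSolution.eq_top (hf : LocallyLipschitz f) (hδ : 0 ≤ δ)
    (h : IsMaximalSolution f δ b φ) {R : ℝ}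
    (hR : ∀ t : ℝ, 0 ≤ t → (t : EReal) < b → ‖φ t‖ ≤ R) : b = ⊤ := by
  induction b with
  | bot => exact absurd h.1.1 (by simp)
  | top => rfl
  | coe β =>
    exfalso
    obtain ⟨M, hM⟩ := (isCompact_closedBall (0 : State n) R).exists_bound_of_continuousOn
      hf.continuous.continuousOn
    -- A bounded solution has bounded speed, so it extends continuously to the endpoint, which
    -- maximality forbids.
    have hlip : LipschitzOnWith (M + δ).toNNReal φ (Ico 0 β) := by
      intro s hs t ht
      have hlt : max s t < β := max_lt hs.2 ht.2
      have h0 : 0 ≤ max s t := hs.1.trans (le_max_left _ _)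
      refine (h.1.solOn hf.continuous h0 (EReal.coe_lt_coe_iff.2 hlt)).lipschitzOnWith
        (M := M) (fun u hu => hM _ (mem_closedBall_zero_iff.2 (hR u hu.1 ?_)))
        ⟨hs.1, le_max_left _ _⟩ ⟨ht.1, le_max_right _ _⟩
      exact EReal.coe_lt_coe_iff.2 (hu.2.trans_lt hlt)
    obtain ⟨ψ, hψ, he⟩ := hlip.extend_finite_dimension
    exact h.not_continuousOn hf hδ (fun t ht => (he ht).symm) hψ.continuous.continuousOn

end

/-! ### Shadowing and the staying set: from reach-avoid-stay to stability -/

section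

variable {f : State n → State n} {δ δ' : ℝ} {b : EReal} {φ ψ : ℝ → State n}

/-- Adding a small displacement that decays linearly to `0` during one time unit turns a solution
for the radius `δ'` into a solution for a larger radius `δ`. -/
theorem SolOn.add_decay {K : Set (State n)} {L : NNReal} (hf : Continuous f)
    (hL : LipschitzOnWith L f K) {T : ℝ} (h : SolOn f δ' 0 T φ) {e : State n}
    (he : δ' + (L + 1) * ‖e‖ ≤ δ) (hφK : ∀ t ∈ Icc 0 T, φ t ∈ K)
    (hψK : ∀ t ∈ Icc 0 T, φ t + max (1 - t) 0 • e ∈ K) :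
    SolOn f δ 0 T (fun t => φ t + max (1 - t) 0 • e) := by
  set ψ : ℝ → State n := fun t => φ t + max (1 - t) 0 • e with hψ
  have hm : Continuous fun t : ℝ => max (1 - t) 0 • e := by fun_prop
  have hψc : ContinuousOn ψ (Icc 0 T) := h.1.add hm.continuousOn
  refine ⟨hψc, fun s t hs hst ht => ?_⟩
  have hts : 0 ≤ t - s := sub_nonneg.2 hst
  have hfψ : IntervalIntegrable (fun u => f (ψ u)) volume s t := by
    apply ContinuousOn.intervalIntegrable
    rw [uIcc_of_le hst]
    exact hf.comp_continuousOn (hψc.mono (Icc_subset_Icc hs ht))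
  have h1 : ‖∫ u in s..t, (f (φ u) - f (ψ u))‖ ≤ L * ‖e‖ * |t - s| := by
    apply intervalIntegral.norm_integral_le_of_norm_le_const
    intro u hu
    rw [uIoc_of_le hst] at hu
    have hu' : u ∈ Icc 0 T := ⟨hs.trans hu.1.le, hu.2.trans ht⟩
    rw [← dist_eq_norm]
    refine (hL.dist_le_mul _ (hφK u hu') _ (hψK u hu')).trans ?_
    refine mul_le_mul_of_nonneg_left ?_ L.2
    rw [dist_self_add_right, norm_smul, Real.norm_of_nonneg (le_max_right _ _)]
    exact mul_le_of_le_one_left (norm_nonneg _) (max_le (by linarith [hu'.1]) zero_le_one)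
  rw [intervalIntegral.integral_sub (h.intervalIntegrable hf hs hst ht) hfψ,
    abs_of_nonneg hts] at h1
  have h2 : ‖(max (1 - t) 0 - max (1 - s) 0) • e‖ ≤ (t - s) * ‖e‖ := by
    rw [norm_smul]
    refine mul_le_mul_of_nonneg_right ?_ (norm_nonneg _)
    refine (abs_max_sub_max_le_abs _ _ _).trans ?_
    rw [sub_sub_sub_cancel_left, abs_sub_comm, abs_of_nonneg hts]
  -- The three summands cost `δ'`, `‖e‖` and `L * ‖e‖` per unit time.
  have h3 : ψ t - ψ s - ∫ u in s..t, f (ψ u) =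
      (φ t - φ s - ∫ u in s..t, f (φ u)) + (max (1 - t) 0 - max (1 - s) 0) • e +
        ((∫ u in s..t, f (φ u)) - ∫ u in s..t, f (ψ u)) := by
    simp only [hψ, sub_smul]
    abel
  rw [h3]
  refine norm_add₃_le.trans ?_
  have h4 := h.2 s t hs hst ht
  have h5 := mul_le_mul_of_nonneg_right he hts
  linarith

/-- The points of `Ω` from which every solution stays in `Ω`. -/
def stayingSet (f : State n → State n) (δ : ℝ) (Ω : Set (State n)) : Set (State n) :=
  {x | x ∈ Ω ∧ ∀ (T : ℝ) (ψ : ℝ → State n), 0 ≤ T → SolOn f δ 0 T ψ → ψ 0 = x → ψ T ∈ Ω}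

/-- Forward invariance: any continuation from `φ T`, concatenated with `φ`, is a solution from `φ
0`. -/
theorem SolOn.mem_stayingSet (hf : Continuous f) {Ω : Set (State n)} {T : ℝ} (hT : 0 ≤ T)
    (h : SolOn f δ 0 T φ) (h0 : φ 0 ∈ stayingSet f δ Ω) : φ T ∈ stayingSet f δ Ω := by
  refine ⟨h0.2 T φ hT h rfl, fun S χ hS hχ hχ0 => ?_⟩
  obtain ⟨ω, hω, hωφ, hωχ⟩ := h.concat hf hT hS hχ hχ0
  rw [← hωχ]
  exact h0.2 (T + S) ω (by linarith) hω (hωφ 0 ⟨le_rfl, hT⟩)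

/-- A maximal solution with a smaller radius that starts close to a point `y` of `stayingSet f δ Ω`
is complete, and is shadowed by a curve in `stayingSet f δ Ω` that it meets after one time unit. -/
theorem IsMaximalSolution.shadow (hf : LocallyLipschitz f) {Ω : Set (State n)} {R : ℝ}
    (hR : ∀ x ∈ Ω, ‖x‖ ≤ R) {L : NNReal}
    (hL : LipschitzOnWith L f (Metric.closedBall 0 (R + 2))) (hδ' : 0 ≤ δ')
    (h : IsMaximalSolution f δ' b φ) {y : State n} (hy : y ∈ stayingSet f δ Ω)
    (hy1 : ‖y - φ 0‖ < 1) (hyδ : δ' + (L + 1) * ‖y - φ 0‖ ≤ δ) :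
    b = ⊤ ∧ ∀ t : ℝ, 0 ≤ t → φ t + max (1 - t) 0 • (y - φ 0) ∈ stayingSet f δ Ω := by
  set e := y - φ 0 with he
  have hm : ∀ t : ℝ, 0 ≤ t → ‖max (1 - t) 0 • e‖ ≤ ‖e‖ := by
    intro t ht
    rw [norm_smul, Real.norm_of_nonneg (le_max_right _ _)]
    exact mul_le_of_le_one_left (norm_nonneg _) (max_le (by linarith) zero_le_one)
  have key : ∀ T : ℝ, 0 ≤ T → (T : EReal) < b → (∀ t ∈ Icc 0 T, ‖φ t‖ ≤ R + 1) →
      φ T + max (1 - T) 0 • e ∈ stayingSet f δ Ω := by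
    intro T hT hTb hb
    refine ((h.1.solOn hf.continuous hT hTb).add_decay hf.continuous hL hyδ
      (fun t ht => ?_) (fun t ht => ?_)).mem_stayingSet hf.continuous hT ?_
    · rw [mem_closedBall_zero_iff]
      linarith [hb t ht]
    · rw [mem_closedBall_zero_iff]
      linarith [hb t ht, hm t ht.1, norm_add_le (φ t) (max (1 - t) 0 • e)]
    · simpa [he] using hy
  -- Bootstrap: while `‖φ‖ ≤ R + 1`, both curves lie in the ball of radius `R + 2` where `L` is
  -- valid, so the shifted one is in `Ω`; then `‖φ‖ ≤ R + ‖e‖ < R + 1`.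
  have hbd : ∀ T : ℝ, 0 ≤ T → (T : EReal) < b → ∀ t ∈ Icc 0 T, ‖φ t‖ ≤ R + 1 := by
    intro T hT hTb t ht
    refine (lt_of_forall_le_imp_lt (h.1.solOn hf.continuous hT hTb).1.norm ?_
      (fun t ht hs => ?_) t ht).le
    · have h1 := norm_sub_le y e
      rw [he, sub_sub_cancel, ← he] at h1
      linarith [hR y hy.1]
    · have h1 := key t ht.1 (lt_of_le_of_lt (EReal.coe_le_coe_iff.2 ht.2) hTb) hs
      have h2 := norm_sub_le (φ t + max (1 - t) 0 • e) (max (1 - t) 0 • e)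
      rw [add_sub_cancel_right] at h2
      linarith [hR _ h1.1, hm t ht.1]
  have hb : b = ⊤ := h.eq_top hf hδ' fun t h0 ht => hbd t h0 ht t ⟨h0, le_rfl⟩
  subst hb
  exact ⟨rfl, fun t ht => key t ht (EReal.coe_lt_top t) (hbd t ht (EReal.coe_lt_top t))⟩

theorem exists_edist_lt_of_infEDist_closure_lt {A : Set (State n)} {x : State n} {r : ℝ}
    (h : Metric.infEDist x (closure A) < ENNReal.ofReal r) : ∃ y ∈ A, ‖y - x‖ < r := by
  rw [Metric.infEDist_closure, Metric.infEDist_lt_iff] at h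
  obtain ⟨y, hy, hxy⟩ := h
  refine ⟨y, hy, ?_⟩
  rw [← dist_eq_norm, dist_comm]
  rw [edist_dist] at hxy
  exact (ENNReal.ofReal_lt_ofReal_iff_of_nonneg dist_nonneg).1 hxy

theorem infEDist_closure_stayingSet_lt {Ω : Set (State n)} {x e : State n} {r ε : ℝ}
    (h : x + e ∈ stayingSet f δ Ω) (he : ‖e‖ ≤ r) (hr : r < ε) :
    Metric.infEDist x (closure (stayingSet f δ Ω)) < ENNReal.ofReal ε := by
  rw [Metric.infEDist_closure]
  refine (Metric.infEDist_le_edist_of_mem h).trans_lt ?_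
  rw [edist_dist, dist_self_add_right]
  exact (ENNReal.ofReal_lt_ofReal_iff_of_nonneg (norm_nonneg _)).2 (he.trans_lt hr)

/-- Shadowing needs only a nearby point of the set itself, and the distances to a set and to its
closure agree, so invariance of the closure is not needed. -/
theorem uniformlyAsymptoticallyStable_closure_stayingSet (hf : LocallyLipschitz f)
    {Ω : Set (State n)} (hΩ : IsCompact Ω) (hδ' : 0 ≤ δ') (hδ : δ' < δ) :
    UniformlyAsymptoticallyStable f δ' (closure (stayingSet f δ Ω)) := by
  obtain ⟨R, hR⟩ := hΩ.exists_bound_of_continuousOn continuousOn_id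
  simp only [id] at hR
  obtain ⟨L, hL⟩ := hf.locallyLipschitzOn.exists_lipschitzOnWith_of_compact
    (isCompact_closedBall (0 : State n) (R + 2))
  set ρ : ℝ := min 1 ((δ - δ') / (L + 1)) with hρ
  have hL0 : (0 : ℝ) < L + 1 := by positivity
  have hρ0 : 0 < ρ := lt_min one_pos (div_pos (by linarith) hL0)
  have hsmall : ∀ r : ℝ, r < ρ → r < 1 ∧ δ' + (L + 1) * r ≤ δ := by
    intro r hr
    refine ⟨hr.trans_le (min_le_left _ _), ?_⟩
    have := (lt_div_iff₀ hL0).1 (hr.trans_le (min_le_right _ _))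
    linarith
  have key : ∀ (x : State n) (p : EReal × (ℝ → State n)), p ∈ solutions f δ' x → ∀ r : ℝ,
      r ≤ ρ → Metric.infEDist x (closure (stayingSet f δ Ω)) < ENNReal.ofReal r →
        p.1 = ⊤ ∧ ∀ t : ℝ, 0 ≤ t → ∃ e : State n, ‖e‖ ≤ max (1 - t) 0 * r ∧
          p.2 t + e ∈ stayingSet f δ Ω := by
    rintro x ⟨b, φ⟩ ⟨hp, rfl⟩ r hr hx
    obtain ⟨y, hy, hyx⟩ := exists_edist_lt_of_infEDist_closure_lt hx
    obtain ⟨h1, h2⟩ := hsmall _ (hyx.trans_le hr)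
    obtain ⟨hb, hs⟩ := hp.shadow hf hR hL hδ' hy h1 h2
    refine ⟨hb, fun t ht => ⟨_, ?_, hs t ht⟩⟩
    rw [norm_smul, Real.norm_of_nonneg (le_max_right _ _)]
    exact mul_le_mul_of_nonneg_left hyx.le (le_max_right _ _)
  -- For attractivity, time `1` serves every `ε`: the displacement has vanished by then.
  refine ⟨fun ε hε => ⟨min ρ (ε / 2), lt_min hρ0 (by linarith), fun x hx p hp => ?_⟩,
    ρ, hρ0, fun ε hε => ⟨1, one_pos, fun x hx p hp => ?_⟩⟩
  · obtain ⟨hb, hs⟩ := key x p hp _ (min_le_left _ _) hx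
    refine ⟨hb, fun t ht => ?_⟩
    obtain ⟨e, he, hmem⟩ := hs t ht
    refine infEDist_closure_stayingSet_lt hmem (r := ε / 2) (he.trans ?_) (by linarith)
    refine (mul_le_of_le_one_left (lt_min hρ0 (by linarith)).le
      (max_le (by linarith) zero_le_one)).trans (min_le_right _ _)
  · obtain ⟨hb, hs⟩ := key x p hp _ le_rfl hx
    refine ⟨hb, fun t ht => ?_⟩
    obtain ⟨e, he, hmem⟩ := hs t (by linarith)
    rw [max_eq_right (by linarith), zero_mul] at he
    exact infEDist_closure_stayingSet_lt hmem he hε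

theorem isSolution_mono_radius (hf : Continuous f) (hδ' : 0 ≤ δ') (hδ : δ' ≤ δ)
    (h : IsSolution f δ' b φ) : IsSolution f δ b φ :=
  (isSolution_iff hf (hδ'.trans hδ)).2 ⟨h.1, fun _ hT hTb =>
    (h.solOn hf hT hTb).mono_radius hδ⟩

/-- If the inclusion of radius `δ` is forward complete on `W`, then a solution of radius `δ' ≤ δ`
from `W` extends to a complete solution of radius `δ`. -/
theorem ForwardComplete.exists_extension (hf : Continuous f) (hδ : 0 ≤ δ) {W : Set (State n)}
    (hW : ForwardComplete f δ W) (h : IsSolution f δ b φ) (h0 : φ 0 ∈ W) :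
    ∃ ψ : ℝ → State n, (⊤, ψ) ∈ solutions f δ (φ 0) ∧
      ∀ t : ℝ, 0 ≤ t → (t : EReal) < b → ψ t = φ t := by
  obtain ⟨b', ψ, hψ, -, he⟩ := h.exists_isMaximalSolution hf hδ
  have hmem : (b', ψ) ∈ solutions f δ (φ 0) :=
    ⟨hψ, he 0 le_rfl (by exact_mod_cast h.1)⟩
  obtain rfl : b' = ⊤ := hW _ h0 _ hmem
  exact ⟨ψ, hmem, he⟩

/-- A `δ'`-solution ending at a finite time would agree with a complete `δ`-solution up to then,
hence extend continuously to its endpoint. -/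
theorem ForwardComplete.mono_radius (hf : LocallyLipschitz f) (hδ' : 0 ≤ δ') (hδ : δ' ≤ δ)
    {W : Set (State n)} (hW : ForwardComplete f δ W) : ForwardComplete f δ' W := by
  rintro x hx ⟨b, φ⟩ ⟨hp, rfl⟩
  obtain ⟨ψ, hψ, he⟩ := hW.exists_extension hf.continuous (hδ'.trans hδ)
    (isSolution_mono_radius hf.continuous hδ' hδ hp.1) hx
  induction b with
  | bot => exact absurd hp.1.1 (by simp)
  | top => rfl
  | coe β =>
    exfalso
    have hβ : 0 < β := EReal.coe_pos.1 hp.1.1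
    exact hp.not_continuousOn hf hδ' (fun t ht => he t ht.1 (EReal.coe_lt_coe_iff.2 ht.2))
      (hψ.1.1.solOn hf.continuous hβ.le (EReal.coe_lt_top β)).1

theorem mem_reachFrom {W : Set (State n)} {T t : ℝ} {x y : State n} (ht : T ≤ t) (hx : x ∈ W)
    {p : EReal × (ℝ → State n)} (hp : p ∈ solutions f δ x) (htp : (t : EReal) < p.1)
    (hy : p.2 t = y) : y ∈ reachFrom f δ T W :=
  mem_iUnion₂.2 ⟨t, ht, x, hx, p, hp, htp, hy⟩

theorem reach_mono_radius (hf : LocallyLipschitz f) (hδ' : 0 ≤ δ') (hδ : δ' ≤ δ)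
    {W : Set (State n)} (hW : ForwardComplete f δ W) : reach f δ' W ⊆ reach f δ W := by
  intro y hy
  obtain ⟨t, ht, x, hx, ⟨b, φ⟩, ⟨hp, rfl⟩, htb, rfl⟩ := mem_iUnion₂.1 hy
  obtain ⟨ψ, hψ, he⟩ := hW.exists_extension hf.continuous (hδ'.trans hδ)
    (isSolution_mono_radius hf.continuous hδ' hδ hp.1) hx
  exact mem_reachFrom ht hx hψ (EReal.coe_lt_top t) (he t ht htb)

/-- Complete solutions from `W` are in the staying set once all reachable points are in `Ω`. -/
theorem mem_stayingSet_of_reachFrom_subset (hf : LocallyLipschitz f) (hδ : 0 ≤ δ)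
    {W Ω : Set (State n)} {T : ℝ} (hT : 0 ≤ T)
    (hreach : reachFrom f δ T W ⊆ Ω) (h : IsSolution f δ ⊤ φ) (h0 : φ 0 ∈ W) {t : ℝ}
    (ht : T ≤ t) : φ t ∈ stayingSet f δ Ω := by
  have ht0 : 0 ≤ t := hT.trans ht
  have hsol := h.solOn hf.continuous ht0 (EReal.coe_lt_top t)
  have main : ∀ (S : ℝ) (χ : ℝ → State n), 0 ≤ S → SolOn f δ 0 S χ → χ 0 = φ t → χ S ∈ Ω := by
    intro S χ hS hχ hχ0
    obtain ⟨ω, hω, hωφ, hωχ⟩ := hsol.concat hf.continuous ht0 hS hχ hχ0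
    obtain ⟨b, ψ, hψ, hb, he⟩ := hω.exists_isMaximalSolution hf hδ (by linarith)
    have hψ0 : ψ 0 = φ 0 := (he 0 ⟨le_rfl, by linarith⟩).trans (hωφ 0 ⟨le_rfl, ht0⟩)
    exact hreach (mem_reachFrom (t := t + S) (by linarith) h0 (p := (b, ψ)) ⟨hψ, hψ0⟩ hb
      ((he _ ⟨by linarith, le_rfl⟩).trans hωχ))
  refine ⟨hreach (mem_reachFrom ht h0 (p := (⊤, φ)) ⟨isMaximalSolution_top h, rfl⟩
    (EReal.coe_lt_top t) rfl), main⟩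

/-- A reach-avoid-stay specification with compact target yields stability with safety guarantee for
all smaller perturbation radii. -/
theorem ReachAvoidStay.stabilityWithSafety (hf : LocallyLipschitz f) {W U Ω : Set (State n)}
    (hΩ : IsCompact Ω) (h : ReachAvoidStay f δ W U Ω) (hδ' : 0 ≤ δ') (hδ : δ' < δ) :
    StabilityWithSafety f δ' W U (closure (stayingSet f δ Ω)) := by
  obtain ⟨⟨hW, T, hT, hreach⟩, hU⟩ := h
  refine ⟨⟨isClosed_closure, uniformlyAsymptoticallyStable_closure_stayingSet hf hΩ hδ' hδ, ?_⟩, ?_⟩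
  · rintro x hx ⟨b, φ⟩ ⟨hp, rfl⟩
    obtain rfl : b = ⊤ := hW.mono_radius hf hδ' hδ.le _ hx (b, φ) ⟨hp, rfl⟩
    refine ⟨rfl, tendsto_const_nhds.congr' ?_⟩
    -- From time `T` on the distance is exactly zero.
    filter_upwards [eventually_ge_atTop T] with t ht
    exact (Metric.infEDist_zero_of_mem (subset_closure
      (mem_stayingSet_of_reachFrom_subset hf (hδ'.trans hδ.le) hT hreach
        (isSolution_mono_radius hf.continuous hδ' hδ.le hp.1) hx ht))).symm
  · rw [← subset_empty_iff, ← hU]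
    exact inter_subset_inter_left _ (reach_mono_radius hf hδ' hδ.le hW)

end

/-! ### Compactness of solutions: from stability to reach-avoid-stay -/

section

variable {f : State n → State n} {δ : ℝ} {b : EReal} {φ ψ : ℝ → State n}

theorem IsSolution.shift (hf : Continuous f) (hδ : 0 ≤ δ) (h : IsSolution f δ ⊤ φ) {r : ℝ}
    (hr : 0 ≤ r) : IsSolution f δ ⊤ (fun t => φ (t + r)) := by
  refine (isSolution_iff hf hδ).2 ⟨by simp, fun T hT _ => ?_⟩
  have := (h.solOn hf (add_nonneg hT hr) (EReal.coe_lt_top _)).shift r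
  rw [add_sub_cancel_right] at this
  exact this.mono (by linarith) le_rfl

/-- Along an ultrafilter, a family of complete solutions starting in a compact set from which the
inclusion is forward complete converges pointwise to a complete solution. -/
theorem exists_tendsto_of_forwardComplete (hf : LocallyLipschitz f) (hδ : 0 ≤ δ)
    {W : Set (State n)} (hWc : IsCompact W) (hW : ForwardComplete f δ W) {ι : Type*}
    (l : Ultrafilter ι) {Φ : ι → ℝ → State n} (hΦ : ∀ k, IsSolution f δ ⊤ (Φ k))
    (h0 : ∀ k, Φ k 0 ∈ W) :
    ∃ φ : ℝ → State n, IsSolution f δ ⊤ φ ∧ φ 0 ∈ W ∧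
      ∀ t : ℝ, 0 ≤ t → Tendsto (fun k => Φ k t) l (𝓝 (φ t)) := by
  classical
  have hsol : ∀ k T, 0 ≤ T → SolOn f δ 0 T (Φ k) := fun k T hT =>
    (hΦ k).solOn hf.continuous hT (EReal.coe_lt_top T)
  -- Times up to which the family is uniformly bounded along the ultrafilter; the limit exists and
  -- is a solution there.
  let J : Set ℝ := {T | ∃ R : ℝ, ∀ᶠ k in l, ∀ t ∈ Icc 0 T, ‖Φ k t‖ ≤ R}
  have hJmono : ∀ S T, S ≤ T → T ∈ J → S ∈ J := by
    rintro S T hST ⟨R, hR⟩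
    exact ⟨R, hR.mono fun k hk t ht => hk t ⟨ht.1, ht.2.trans hST⟩⟩
  have hlimJ : ∀ t, 0 ≤ t → t ∈ J → ∃ x, Tendsto (fun k => Φ k t) l (𝓝 x) := by
    rintro t ht ⟨R, hR⟩
    obtain ⟨x, -, hx⟩ := (isCompact_closedBall (0 : State n) R).ultrafilter_le_nhds'
      (l.map fun k => Φ k t)
      (hR.mono fun k hk => mem_closedBall_zero_iff.2 (hk t ⟨ht, le_rfl⟩))
    exact ⟨x, hx⟩
  let φ : ℝ → State n := fun t =>
    if h : ∃ x, Tendsto (fun k => Φ k t) l (𝓝 x) then h.choose else 0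
  have hφ : ∀ t, 0 ≤ t → t ∈ J → Tendsto (fun k => Φ k t) l (𝓝 (φ t)) := by
    intro t ht hJ
    have h := hlimJ t ht hJ
    have e : φ t = h.choose := dif_pos h
    rw [e]
    exact h.choose_spec
  have hφsol : ∀ T, T ∈ J → SolOn f δ 0 T φ := by
    intro T hTJ
    obtain ⟨R, hR⟩ := id hTJ
    refine SolOn.of_tendsto hf (l := (l : Filter ι)) (Φ := Φ) (R := R)
      (Eventually.of_forall fun k => ?_) hR fun t ht => hφ t ht.1 (hJmono t T ht.2 hTJ)
    rcases le_or_gt 0 T with hT | hT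
    · exact hsol k T hT
    · exact (hsol k 0 le_rfl).mono le_rfl hT.le
  obtain ⟨R₀, hR₀⟩ := hWc.exists_bound_of_continuousOn continuousOn_id
  have h0J : (0 : ℝ) ∈ J := by
    refine ⟨R₀, Eventually.of_forall fun k t ht => ?_⟩
    obtain rfl : t = 0 := le_antisymm ht.2 ht.1
    exact hR₀ _ (h0 k)
  have hφ0 : φ 0 ∈ W := hWc.isClosed.mem_of_tendsto (hφ 0 le_rfl h0J) (Eventually.of_forall h0)
  -- If the limit has norm at most `R` at `T`, then along the ultrafilter `‖Φ k T‖ < R + 1`, and the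
  -- norm stays below `R + 2` for a time depending on `R` only.
  have hstep : ∀ R : ℝ, ∃ h > 0, ∀ T, 0 ≤ T → T ∈ J → ‖φ T‖ ≤ R → T + h ∈ J := by
    intro R
    obtain ⟨M, hM⟩ := (isCompact_closedBall (0 : State n) (R + 1 + 1)).exists_bound_of_continuousOn
      hf.continuous.continuousOn
    have hM0 : 0 ≤ max M 0 + δ := add_nonneg (le_max_right _ _) hδ
    refine ⟨1 / (max M 0 + δ + 1), by positivity, fun T hT hTJ hTR => ?_⟩
    obtain ⟨R', hR'⟩ := id hTJ
    have hev : ∀ᶠ k in l, ‖Φ k T‖ < R + 1 :=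
      (hφ T hT hTJ).norm.eventually (gt_mem_nhds (by linarith))
    refine ⟨max R' (R + 1 + 1), ?_⟩
    filter_upwards [hR', hev] with k hk hkT t ht
    rcases le_total t T with htT | hTt
    · exact (hk t ⟨ht.1, htT⟩).trans (le_max_left _ _)
    · refine le_trans ?_ (le_max_right _ _)
      have hh : 0 ≤ 1 / (max M 0 + δ + 1) := by positivity
      refine ((hsol k _ (add_nonneg hT hh)).mono hT le_rfl).norm_le_add_one (M := max M 0)
        (fun x hx => (hM x (mem_closedBall_zero_iff.2 hx)).trans (le_max_left _ _)) hkT.le hM0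
        ?_ t ⟨hTt, ht.2⟩
      rw [add_sub_cancel_left, mul_one_div, div_lt_one (by linarith)]
      linarith
  have hall : ∀ T, T ∈ J := by
    by_contra! hcon
    obtain ⟨S, hS⟩ := hcon
    have hbdd : BddAbove J := ⟨S, fun T hT => le_of_not_ge fun hST => hS (hJmono S T hST hT)⟩
    set β := sSup J with hβ
    have hlt : ∀ T, T < β → T ∈ J := by
      intro T hT
      obtain ⟨T', hT', hTT'⟩ := exists_lt_of_lt_csSup ⟨0, h0J⟩ hT
      exact hJmono T T' hTT'.le hT'
    have hβ0 : 0 < β := by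
      obtain ⟨h, hh, hstep'⟩ := hstep ‖φ 0‖
      have := le_csSup hbdd (hstep' 0 le_rfl h0J le_rfl)
      linarith
    have hφβ : IsSolution f δ β φ := (isSolution_iff hf.continuous hδ).2
      ⟨EReal.coe_pos.2 hβ0, fun T _ hTβ => hφsol T (hlt T (EReal.coe_lt_coe_iff.1 hTβ))⟩
    -- Forward completeness rules out blow-up of the limit at `β`. It is thus bounded on `[0, β)`,
    -- and a step of length `h` from within `h / 2` of `β` passes beyond `sup J`.
    obtain ⟨ψ, hψ, he⟩ := hW.exists_extension hf.continuous hδ hφβ hφ0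
    obtain ⟨R, hR⟩ := isCompact_Icc.exists_bound_of_continuousOn
      (hψ.1.1.solOn hf.continuous hβ0.le (EReal.coe_lt_top β)).1
    obtain ⟨h, hh, hstep'⟩ := hstep R
    have hT1 : max 0 (β - h / 2) < β := max_lt hβ0 (by linarith)
    have hT0 : 0 ≤ max 0 (β - h / 2) := le_max_left _ _
    have hle := le_csSup hbdd (hstep' _ hT0 (hlt _ hT1) (by
      rw [← he _ hT0 (EReal.coe_lt_coe_iff.2 hT1)]
      exact hR _ ⟨hT0, hT1.le⟩))
    linarith [le_max_right 0 (β - h / 2)]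
  exact ⟨φ, (isSolution_iff hf.continuous hδ).2 ⟨by simp, fun T _ _ => hφsol T (hall T)⟩, hφ0,
    fun t ht => hφ t ht (hall t)⟩

/-- Stability with safety guarantee yields a reach-avoid-stay specification for every closed
neighbourhood of the attracting set. -/
theorem StabilityWithSafety.reachAvoidStay (hf : LocallyLipschitz f) (hδ : 0 ≤ δ)
    {W U A : Set (State n)} (hWc : IsCompact W) (h : StabilityWithSafety f δ W U A) {ε : ℝ}
    (hε : 0 < ε) : ReachAvoidStay f δ W U (nbhd A ε) := by
  obtain ⟨⟨-, ⟨hstab, -⟩, hattr⟩, hU⟩ := h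
  have hW : ForwardComplete f δ W := fun x hx p hp => (hattr hx p hp).1
  refine ⟨⟨hW, ?_⟩, hU⟩
  by_contra! hcon
  obtain ⟨η, hη, hη'⟩ := hstab ε hε
  have hbad : ∀ k : ℕ, ∃ Φ : ℝ → State n, IsSolution f δ ⊤ Φ ∧ Φ 0 ∈ W ∧
      ∀ t : ℝ, 0 ≤ t → t ≤ k → ENNReal.ofReal η ≤ Metric.infEDist (Φ t) A := by
    intro k
    obtain ⟨y, hy, hyA⟩ := not_subset.1 (hcon k k.cast_nonneg)
    obtain ⟨s, hs, x, hx, ⟨b, Φ⟩, hp, -, rfl⟩ := mem_iUnion₂.1 hy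
    obtain rfl : b = ⊤ := hW x hx _ hp
    refine ⟨Φ, hp.1.1, (show Φ 0 = x from hp.2) ▸ hx, fun t ht htk => ?_⟩
    by_contra! hlt
    apply hyA
    have hts : t ≤ s := htk.trans hs
    -- Once within `η` of `A`, the solution restarted at `t` stays within `ε`, contrary to its
    -- position at the late time `s`.
    have := (hη' _ hlt (⊤, fun r => Φ (r + t)) ⟨isMaximalSolution_top
      (hp.1.1.shift hf.continuous hδ ht), by simp⟩).2 (s - t) (sub_nonneg.2 hts)
    simp only [sub_add_cancel] at this
    obtain ⟨z, hz, hzs⟩ := Metric.infEDist_lt_iff.1 this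
    refine mem_iUnion₂.2 ⟨z, hz, ?_⟩
    rw [edist_dist] at hzs
    exact ((ENNReal.ofReal_lt_ofReal_iff hε).1 hzs).le
  choose Φ hΦ hΦ0 hΦη using hbad
  obtain ⟨φ, hφ, hφ0, hlim⟩ :=
    exists_tendsto_of_forwardComplete hf hδ hWc hW (hyperfilter ℕ) hΦ hΦ0
  have hφη : ∀ t : ℝ, 0 ≤ t → ENNReal.ofReal η ≤ Metric.infEDist (φ t) A := by
    intro t ht
    refine ge_of_tendsto ((Metric.continuous_infEDist.tendsto (φ t)).comp (hlim t ht)) ?_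
    -- The ultrafilter is nonprincipal, so each fixed `t` is eventually below `k`.
    have hev : ∀ᶠ k : ℕ in hyperfilter ℕ, t ≤ k := by
      refine Nat.hyperfilter_le_atTop ?_
      exact tendsto_natCast_atTop_atTop.eventually (eventually_ge_atTop t)
    filter_upwards [hev] with k hk using hΦη k t ht hk
  have htend := (hattr hφ0 (⊤, φ) ⟨isMaximalSolution_top hφ, rfl⟩).2
  have hpos : (0 : ENNReal) < ENNReal.ofReal η := ENNReal.ofReal_pos.2 hη
  obtain ⟨t, ht, ht'⟩ := ((htend.eventually (gt_mem_nhds hpos)).and (eventually_ge_atTop 0)).exists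
  exact absurd (hφη t ht') (not_le.2 ht)

end

end PerturbedSystem

theorem mainTheorem8 {n : ℕ}
    (f : PerturbedSystem.State n → PerturbedSystem.State n) (hf : LocallyLipschitz f)
    (δ : ℝ) (hδ : 0 ≤ δ) (W U : Set (PerturbedSystem.State n)) :
    (∀ A : Set (PerturbedSystem.State n), IsCompact W →
      PerturbedSystem.StabilityWithSafety f δ W U A →
        ∀ ε : ℝ, 0 < ε →
          PerturbedSystem.ReachAvoidStay f δ W U (PerturbedSystem.nbhd A ε)) ∧
    (∀ Ω : Set (PerturbedSystem.State n), IsCompact Ω →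
      PerturbedSystem.ReachAvoidStay f δ W U Ω →
        ∃ A : Set (PerturbedSystem.State n), IsCompact A ∧ A ⊆ Ω ∧
          ∀ δ' : ℝ, 0 ≤ δ' → δ' < δ →
            PerturbedSystem.StabilityWithSafety f δ' W U A) := by
  refine ⟨fun A hW h ε hε => h.reachAvoidStay hf hδ hW hε, fun Ω hΩ h => ?_⟩
  have hsub : closure (PerturbedSystem.stayingSet f δ Ω) ⊆ Ω :=
    closure_minimal (fun x hx => hx.1) hΩ.isClosed
  exact ⟨_, hΩ.of_isClosed_subset isClosed_closure hsub, hsub, fun δ' hδ' hlt =>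
    h.stabilityWithSafety hf hΩ hδ' hlt⟩
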